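/- Let $\mathcal L$ be a (possibly many-sorted) metric language: every sort has a bound on its diameter, function and relation symbols have moduli of uniform continuity, and every relation symbol takes values in a fixed compact interval. Formulas are those of continuous logic: they are built from atomic formulas (relation symbols and the metrics) by continuous connectives $\mathbb R^n\to\mathbb R$ and the quantifiers $\sup_x,\inf_x$ over sorts. All sorts of structures are nonempty, and all ideals on sets are proper. For an ideal $\mathcal I$ on a set $\mathbb J$ and $\mathcal L$-structures $(M_j)_{j\in\mathbb J}$, the reduced product $\prod_j M_j/\mathcal I$ is the quotient (in each sort) of the product by the pseudometric $d(a,b)=\inf_{X\in\mathcal I}\sup_{j\notin X}d(a_j,b_j)$; functions are interpreted pointwise, and relations by $R(\bar a)=\inf_{X\in\mathcal I}\sup_{j\notin X}R^{M_j}(\bar a_j)$. If $\mathcal I\subseteq\mathcal J$ are ideals on $\mathbb J$, then $\pi_{\mathcal J}\colon\prod_j M_j/\mathcal I\to\prod_j M_j/\mathcal J$ is the quotient map. Let $\mathcal L^2$ be the language of the structures $(\prod_j M_j/\mathcal I,\prod_j M_j/\mathcal J,\pi_{\mathcal J})$: it has two copies of every sort, function symbol and relation symbol of $\mathcal L$,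 and symbols for $\pi_{\mathcal J}$. Consider the first-order language of Boolean algebras ($\wedge,\vee,{}^\complement,0,1$) with an additional unary predicate $\mathbb U$ and constants $Z^\zeta_t$, for $\mathcal L$-formulas $\zeta$ and $t\in\mathbb Q$. A sentence $\theta$ of this language is increasing if, in every Boolean algebra in which $\mathbb U$ is interpreted as the complement of an ideal (here not necessarily proper), $\theta$ remains true whenever the interpretations of the constants are replaced by larger elements. Theorem. For every metric language $\mathcal L$ and every $k\ge 2$, every $\mathcal L^2$-formula $\varphi(\bar x)$ is $k$-determined. This means that there exist a finite set $\mathbb F$ of $\mathcal L$-formulas whose free variables are among the free variables of $\varphi$ (each variable being regarded as a variable of the corresponding sort of $\mathcal L$) and increasing sentences $\theta_0,\dots,\theta_k$ of the above language, in which only constants $Z^\zeta_t$ with $\zeta\in\mathbb F$ and $t\in\mathbb Q\cap[0,1]$ occur, such that the following holds. For every family $(M_j)_{j\in\mathbb J}$ of $\mathcal L$-structures, all ideals $\mathcal I\subseteq\mathcal J$ on $\mathbb J$, every tuple $\bar a$ of sequences $a(i)=(a_j(i))_{j\in\mathbb J}$ in $\prod_j M_j$ (of the sorts of $\bar x$),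 and every $0\le l\le k$, with $M=(\prod_j M_j/\mathcal I,\prod_j M_j/\mathcal J,\pi_{\mathcal J})$ we have \[ \varphi^M(\bar a)>\tfrac{l+1}{k}\ \Longrightarrow\ \theta_l[\bar a] \qquad\text{and}\qquad \theta_l[\bar a]\ \Longrightarrow\ \varphi^M(\bar a)>\tfrac{l-1}{k}. \] Here $\varphi^M(\bar a)$ is the value of $\varphi$ at the classes of the sequences $a(i)$ in the sorts of $\bar x$, and $\theta_l[\bar a]$ is the truth value of $\theta_l$ in the Boolean algebra $\mathcal P(\mathbb J)/\mathcal I$, where $Z^\zeta_t$ is interpreted as the class of $\{j\in\mathbb J:\zeta^{M_j}(\bar a_j)>t\}$ modulo $\mathcal I$ and $\mathbb U$ holds of the class of $X$ if and only if $X\notin\mathcal J$. -/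

import Mathlib

universe u v w x y

noncomputable section

open Set

namespace ContLogic

/-! ## Metric languages, metric structures, formulas of continuous logic -/

/-- A (many-sorted) metric language: each sort carries a bound on its diameter, each function and
relation symbol carries a modulus of uniform continuity, and each relation symbol carries a compact
interval in which it takes its values. -/
structure MetricLanguage where
  Sorts : Type u
  diam : Sorts → ℝ
  Func : Type u
  funArity : Func → ℕ
  funDom : ∀ f : Func, Fin (funArity f) → Sorts
  funCod : Func → Sorts
  funMod : Func → ℝ → ℝ
  funMod_pos : ∀ f ε, 0 < ε → 0 < funMod f ε
  Rel : Type u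
  relArity : Rel → ℕ
  relDom : ∀ R : Rel, Fin (relArity R) → Sorts
  relLo : Rel → ℝ
  relHi : Rel → ℝ
  relLo_le_relHi : ∀ R, relLo R ≤ relHi R
  relMod : Rel → ℝ → ℝ
  relMod_pos : ∀ R ε, 0 < ε → 0 < relMod R ε

/-- A metric structure in the language `L`. The sorts are nonempty metric spaces; they may be
complete, but this is not required. -/
structure MetricStructure (L : MetricLanguage.{u}) where
  carrier : L.Sorts → Type v
  metric : ∀ s, MetricSpace (carrier s)
  nonempty : ∀ s, Nonempty (carrier s)
  dist_le : ∀ s (a b : carrier s), dist a b ≤ L.diam s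
  fn : ∀ f : L.Func, (∀ i, carrier (L.funDom f i)) → carrier (L.funCod f)
  fn_unif : ∀ (f : L.Func) (ε : ℝ), 0 < ε → ∀ a b : (∀ i, carrier (L.funDom f i)),
    (∀ i, dist (a i) (b i) < L.funMod f ε) → dist (fn f a) (fn f b) ≤ ε
  rel : ∀ R : L.Rel, (∀ i, carrier (L.relDom R i)) → ℝ
  rel_mem : ∀ (R : L.Rel) (a : ∀ i, carrier (L.relDom R i)),
    rel R a ∈ Icc (L.relLo R) (L.relHi R)
  rel_unif : ∀ (R : L.Rel) (ε : ℝ), 0 < ε → ∀ a b : (∀ i, carrier (L.relDom R i)),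
    (∀ i, dist (a i) (b i) < L.relMod R ε) → |rel R a - rel R b| ≤ ε

attribute [instance] MetricStructure.metric MetricStructure.nonempty

/-- Terms over a type `V` of variables, where the variable `x : V` has sort `σ x`. -/
inductive Term (L : MetricLanguage.{u}) {V : Type y} (σ : V → L.Sorts) :
    L.Sorts → Type (max u y)
  | var (x : V) : Term L σ (σ x)
  | app (f : L.Func) (ts : ∀ i, Term L σ (L.funDom f i)) : Term L σ (L.funCod f)

/-- Formulas of continuous logic: atomic formulas, arbitrary continuous connectives, and the
quantifiers `sup` and `inf` over variables. -/
inductive Formula (L : MetricLanguage.{u}) {V : Type y} (σ : V → L.Sorts) : Type (max u y)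
  | dist {s : L.Sorts} (t₁ t₂ : Term L σ s) : Formula L σ
  | rel (R : L.Rel) (ts : ∀ i, Term L σ (L.relDom R i)) : Formula L σ
  | conn (n : ℕ) (c : C(Fin n → ℝ, ℝ)) (φ : Fin n → Formula L σ) : Formula L σ
  | sup (x : V) (φ : Formula L σ) : Formula L σ
  | inf (x : V) (φ : Formula L σ) : Formula L σ

section Semantics

variable {L : MetricLanguage.{u}} {V : Type y} {σ : V → L.Sorts}

/-- The variables of a term. -/
def Term.vars : ∀ {s : L.Sorts}, Term L σ s → Set V
  | _, .var x => {x}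
  | _, .app _ ts => ⋃ i, (ts i).vars

/-- The free variables of a formula. -/
def Formula.freeVars : Formula L σ → Set V
  | .dist t₁ t₂ => t₁.vars ∪ t₂.vars
  | .rel _ ts => ⋃ i, (ts i).vars
  | .conn _ _ φ => ⋃ i, (φ i).freeVars
  | .sup x φ => φ.freeVars \ {x}
  | .inf x φ => φ.freeVars \ {x}

/-- The value of a term in a structure, under an assignment of the variables. -/
def Term.eval (M : MetricStructure.{u, v} L) (a : ∀ x, M.carrier (σ x)) :
    ∀ {s : L.Sorts}, Term L σ s → M.carrier s
  | _, .var x => a x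
  | _, .app f ts => M.fn f fun i => (ts i).eval M a

open Classical in
/-- The value of a formula in a structure, under an assignment of the variables. -/
def Formula.eval (M : MetricStructure.{u, v} L) :
    Formula L σ → (∀ x, M.carrier (σ x)) → ℝ
  | .dist t₁ t₂, a => Dist.dist (t₁.eval M a) (t₂.eval M a)
  | .rel R ts, a => M.rel R fun i => (ts i).eval M a
  | .conn _ c φ, a => c fun i => (φ i).eval M a
  | .sup x φ, a => ⨆ b : M.carrier (σ x), φ.eval M (Function.update a x b)
  | .inf x φ, a => ⨅ b : M.carrier (σ x), φ.eval M (Function.update a x b)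

end Semantics

/-! ## Reduced products -/

section ReducedProduct

variable {ι : Type w}

/-- The upper limit of `f` along the ideal `I`: `inf_{X ∈ I} sup_{j ∉ X} f j`. -/
def limsupAlong (I : Order.Ideal (Set ι)) (f : ι → ℝ) : ℝ :=
  ⨅ X : {X : Set ι // X ∈ I}, ⨆ j : {j : ι // j ∉ X.1}, f j.1

theorem exists_notMem_of_mem {I : Order.Ideal (Set ι)} (hI : I.IsProper) {X : Set ι}
    (hX : X ∈ I) : ∃ j, j ∉ X := by
  by_contra! h
  have hX' : X = (⊤ : Set ι) := Set.eq_univ_of_forall h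
  exact (Order.Ideal.isProper_iff_top_notMem.1 hI) (hX' ▸ hX)

theorem le_iSup_compl {f : ι → ℝ} {lo hi : ℝ} (hf : ∀ j, f j ∈ Icc lo hi) {X : Set ι} {j : ι}
    (hj : j ∉ X) : f j ≤ ⨆ k : {k : ι // k ∉ X}, f k.1 :=
  le_ciSup (f := fun k : {k : ι // k ∉ X} => f k.1)
    ⟨hi, by rintro _ ⟨k, rfl⟩; exact (hf k.1).2⟩ ⟨j, hj⟩

theorem le_limsupAlong {I : Order.Ideal (Set ι)} (hI : I.IsProper) {f : ι → ℝ} {lo hi : ℝ}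
    (hf : ∀ j, f j ∈ Icc lo hi) : lo ≤ limsupAlong I f := by
  have : Nonempty {X : Set ι // X ∈ I} := ⟨⟨⊥, I.bot_mem⟩⟩
  refine le_ciInf fun X => ?_
  obtain ⟨j, hj⟩ := exists_notMem_of_mem hI X.2
  exact (hf j).1.trans (le_iSup_compl hf hj)

theorem limsupAlong_le {I : Order.Ideal (Set ι)} (hI : I.IsProper) {f : ι → ℝ} {lo hi c : ℝ}
    (hf : ∀ j, f j ∈ Icc lo hi) {X : Set ι} (hX : X ∈ I) (h : ∀ j ∉ X, f j ≤ c) :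
    limsupAlong I f ≤ c := by
  have hbb : BddBelow (range fun X : {X : Set ι // X ∈ I} =>
      ⨆ j : {j : ι // j ∉ X.1}, f j.1) := by
    refine ⟨lo, ?_⟩
    rintro _ ⟨Y, rfl⟩
    obtain ⟨j, hj⟩ := exists_notMem_of_mem hI Y.2
    exact (hf j).1.trans (le_iSup_compl hf hj)
  refine (ciInf_le hbb ⟨X, hX⟩).trans ?_
  obtain ⟨j, hj⟩ := exists_notMem_of_mem hI hX
  have : Nonempty {j : ι // j ∉ X} := ⟨⟨j, hj⟩⟩
  exact ciSup_le fun k => h k.1 k.2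

theorem exists_of_limsupAlong_lt {I : Order.Ideal (Set ι)} {f : ι → ℝ} {lo hi c : ℝ}
    (hf : ∀ j, f j ∈ Icc lo hi) (h : limsupAlong I f < c) : ∃ X ∈ I, ∀ j ∉ X, f j < c := by
  have : Nonempty {X : Set ι // X ∈ I} := ⟨⟨⊥, I.bot_mem⟩⟩
  obtain ⟨X, hX⟩ := exists_lt_of_ciInf_lt h
  exact ⟨X.1, X.2, fun j hj => (le_iSup_compl hf hj).trans_lt hX⟩

theorem limsupAlong_anti {I J : Order.Ideal (Set ι)} (hJ : J.IsProper) (hIJ : I ≤ J) {f : ι → ℝ} {lo hi : ℝ} (hf : ∀ j, f j ∈ Icc lo hi) :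
    limsupAlong J f ≤ limsupAlong I f := by
  refine le_of_forall_pos_le_add fun ε hε => ?_
  obtain ⟨X, hX, hX'⟩ := exists_of_limsupAlong_lt (I := I) hf (lt_add_of_pos_right _ hε)
  exact limsupAlong_le hJ hf (hIJ hX) fun j hj => (hX' j hj).le

variable {L : MetricLanguage.{u}}

/-- The sort `s` of the product of the `M j`, with the pseudometric given by the ideal `I`. -/
def PreSort (M : ι → MetricStructure.{u, v} L) (_I : Order.Ideal (Set ι)) (s : L.Sorts) :
    Type (max w v) :=
  ∀ j, (M j).carrier s

theorem dist_mem_Icc (M : MetricStructure.{u, v} L) {s : L.Sorts} (a b : M.carrier s) :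
    dist a b ∈ Icc 0 (L.diam s) := ⟨dist_nonneg, M.dist_le s a b⟩

instance (M : ι → MetricStructure.{u, v} L) (I : Order.Ideal (Set ι)) [hI : I.IsProper]
    (s : L.Sorts) : PseudoMetricSpace (PreSort M I s) where
  dist a b := limsupAlong I fun j => dist (a j) (b j)
  dist_self a := by
    refine le_antisymm ?_ ?_
    · exact limsupAlong_le hI (fun j => dist_mem_Icc (M j) (a j) (a j)) I.bot_mem
        (fun j _ => by simp)
    · exact le_limsupAlong hI (fun j => dist_mem_Icc (M j) (a j) (a j))
  dist_comm a b := by simp only [dist_comm]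
  dist_triangle a b c := by
    have hm := fun (a b : PreSort M I s) j => dist_mem_Icc (M j) (a j) (b j)
    refine le_of_forall_pos_le_add fun ε hε => ?_
    obtain ⟨X, hX, hX'⟩ := exists_of_limsupAlong_lt (I := I) (hm a b)
      (lt_add_of_pos_right _ (half_pos hε))
    obtain ⟨Y, hY, hY'⟩ := exists_of_limsupAlong_lt (I := I) (hm b c)
      (lt_add_of_pos_right _ (half_pos hε))
    refine limsupAlong_le hI (hm a c) (Order.Ideal.sup_mem hX hY) fun j hj => ?_
    have h1 := hX' j fun h => hj (Or.inl h)
    have h2 := hY' j fun h => hj (Or.inr h)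
    have h3 := dist_triangle (a j) (b j) (c j)
    linarith

/-- The sort `s` of the reduced product of the `M j` modulo `I`: sequences are identified when
their distance is zero. -/
abbrev ReducedSort (M : ι → MetricStructure.{u, v} L) (I : Order.Ideal (Set ι)) [I.IsProper]
    (s : L.Sorts) : Type (max w v) :=
  SeparationQuotient (PreSort M I s)

section

variable {M : ι → MetricStructure.{u, v} L} {I : Order.Ideal (Set ι)} [hI : I.IsProper]

/-- The class of a sequence in the reduced product. -/
def ReducedSort.mk (I : Order.Ideal (Set ι)) [I.IsProper] {s : L.Sorts}
    (a : ∀ j, (M j).carrier s) : ReducedSort M I s :=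
  SeparationQuotient.mk (X := PreSort M I s) a

/-- A representing sequence of an element of the reduced product. -/
def ReducedSort.rep {s : L.Sorts} (p : ReducedSort M I s) : ∀ j, (M j).carrier s :=
  Function.surjInv (SeparationQuotient.surjective_mk (X := PreSort M I s)) p

@[simp]
theorem ReducedSort.mk_rep {s : L.Sorts} (p : ReducedSort M I s) : mk I p.rep = p :=
  Function.surjInv_eq _ p

theorem ReducedSort.dist_mk {s : L.Sorts} (a b : ∀ j, (M j).carrier s) :
    dist (mk I a) (mk I b) = limsupAlong I fun j => dist (a j) (b j) := rfl

theorem ReducedSort.dist_eq {s : L.Sorts} (p q : ReducedSort M I s) :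
    dist p q = limsupAlong I fun j => dist (p.rep j) (q.rep j) := by
  rw [← dist_mk, mk_rep, mk_rep]

theorem ReducedSort.exists_of_dist_lt {n : ℕ} {s : Fin n → L.Sorts}
    {a b : ∀ i, ∀ j, (M j).carrier (s i)} {δ : ℝ}
    (h : ∀ i, dist (mk I (a i)) (mk I (b i)) < δ) :
    ∃ X ∈ I, ∀ j ∉ X, ∀ i, dist (a i j) (b i j) < δ := by
  have h' : ∀ i, ∃ X ∈ I, ∀ j ∉ X, dist (a i j) (b i j) < δ := fun i =>
    exists_of_limsupAlong_lt (fun j => dist_mem_Icc (M j) (a i j) (b i j)) (h i)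
  choose X hX hX' using h'
  refine ⟨⨆ i, X i, Order.Ideal.iSup_mem_iff.2 hX, fun j hj i => hX' i j fun hi => hj ?_⟩
  exact Set.mem_iUnion.2 ⟨i, hi⟩

/-- A function symbol acts on the reduced product pointwise on representing sequences. -/
def reducedFn (M : ι → MetricStructure.{u, v} L) (I : Order.Ideal (Set ι)) [I.IsProper]
    (f : L.Func) (p : ∀ i, ReducedSort M I (L.funDom f i)) : ReducedSort M I (L.funCod f) :=
  ReducedSort.mk I fun j => (M j).fn f fun i => (p i).rep j

/-- A relation symbol is interpreted in the reduced product by the upper limit along the ideal. -/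
def reducedRel (M : ι → MetricStructure.{u, v} L) (I : Order.Ideal (Set ι)) [I.IsProper]
    (R : L.Rel) (p : ∀ i, ReducedSort M I (L.relDom R i)) : ℝ :=
  limsupAlong I fun j => (M j).rel R fun i => (p i).rep j

theorem dist_fn_le {f : L.Func} {a b : ∀ i, ∀ j, (M j).carrier (L.funDom f i)} {ε : ℝ}
    (hε : 0 < ε)
    (h : ∀ i, dist (ReducedSort.mk I (a i)) (ReducedSort.mk I (b i)) < L.funMod f ε) :
    dist (ReducedSort.mk I fun j => (M j).fn f fun i => a i j)
      (ReducedSort.mk I fun j => (M j).fn f fun i => b i j) ≤ ε := by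
  obtain ⟨X, hX, hX'⟩ := ReducedSort.exists_of_dist_lt h
  exact limsupAlong_le hI (fun j => dist_mem_Icc (M j) _ _) hX
    fun j hj => (M j).fn_unif f ε hε _ _ (hX' j hj)

theorem limsupAlong_rel_le {R : L.Rel} {a b : ∀ i, ∀ j, (M j).carrier (L.relDom R i)} {ε : ℝ}
    (hε : 0 < ε)
    (h : ∀ i, dist (ReducedSort.mk I (a i)) (ReducedSort.mk I (b i)) < L.relMod R ε) :
    limsupAlong I (fun j => (M j).rel R fun i => a i j) ≤
      limsupAlong I (fun j => (M j).rel R fun i => b i j) + ε := by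
  obtain ⟨X, hX, hX'⟩ := ReducedSort.exists_of_dist_lt h
  refine le_of_forall_pos_le_add fun η hη => ?_
  obtain ⟨Y, hY, hY'⟩ := exists_of_limsupAlong_lt (I := I)
    (fun j => (M j).rel_mem R fun i => b i j) (lt_add_of_pos_right _ hη)
  refine limsupAlong_le hI (fun j => (M j).rel_mem R _) (Order.Ideal.sup_mem hX hY)
    fun j hj => ?_
  have h1 := abs_le.1 ((M j).rel_unif R ε hε _ _ (hX' j fun h => hj (Or.inl h)))
  have h2 := hY' j fun h => hj (Or.inr h)
  linarith [h1.2]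

/-- The interpretation of a function symbol does not depend on the representing sequences. -/
theorem reducedFn_mk (f : L.Func) (a : ∀ i, ∀ j, (M j).carrier (L.funDom f i)) :
    reducedFn M I f (fun i => ReducedSort.mk I (a i)) =
      ReducedSort.mk I fun j => (M j).fn f fun i => a i j := by
  refine dist_le_zero.1 (le_of_forall_pos_le_add fun ε hε => ?_)
  rw [zero_add]
  refine dist_fn_le hε fun i => ?_
  rw [ReducedSort.mk_rep, dist_self]
  exact L.funMod_pos f ε hε

/-- The interpretation of a relation symbol does not depend on the representing sequences. -/
theorem reducedRel_mk (R : L.Rel) (a : ∀ i, ∀ j, (M j).carrier (L.relDom R i)) :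
    reducedRel M I R (fun i => ReducedSort.mk I (a i)) =
      limsupAlong I fun j => (M j).rel R fun i => a i j := by
  refine le_antisymm (le_of_forall_pos_le_add fun ε hε => ?_)
    (le_of_forall_pos_le_add fun ε hε => ?_) <;>
  · refine limsupAlong_rel_le hε fun i => ?_
    rw [ReducedSort.mk_rep, dist_self]
    exact L.relMod_pos R ε hε

theorem dist_reducedFn_le (f : L.Func) {ε : ℝ} (hε : 0 < ε)
    {p q : ∀ i, ReducedSort M I (L.funDom f i)} (h : ∀ i, dist (p i) (q i) < L.funMod f ε) :
    dist (reducedFn M I f p) (reducedFn M I f q) ≤ ε :=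
  dist_fn_le hε fun i => by simpa using h i

theorem abs_reducedRel_sub_le (R : L.Rel) {ε : ℝ} (hε : 0 < ε)
    {p q : ∀ i, ReducedSort M I (L.relDom R i)} (h : ∀ i, dist (p i) (q i) < L.relMod R ε) :
    |reducedRel M I R p - reducedRel M I R q| ≤ ε := by
  have h1 : reducedRel M I R p ≤ reducedRel M I R q + ε :=
    limsupAlong_rel_le hε fun i => by simpa using h i
  have h2 : reducedRel M I R q ≤ reducedRel M I R p + ε :=
    limsupAlong_rel_le hε fun i => by simpa [dist_comm] using h i
  exact abs_le.2 ⟨by linarith, by linarith⟩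

theorem reducedRel_mem (R : L.Rel) (p : ∀ i, ReducedSort M I (L.relDom R i)) :
    reducedRel M I R p ∈ Icc (L.relLo R) (L.relHi R) :=
  ⟨le_limsupAlong hI fun j => (M j).rel_mem R _,
    limsupAlong_le hI (fun j => (M j).rel_mem R _) I.bot_mem fun j _ => ((M j).rel_mem R _).2⟩

theorem ReducedSort.dist_le {s : L.Sorts} (p q : ReducedSort M I s) : dist p q ≤ L.diam s := by
  rw [dist_eq]
  exact limsupAlong_le hI (fun j => dist_mem_Icc (M j) _ _) I.bot_mem
    fun j _ => (M j).dist_le s _ _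

instance (s : L.Sorts) : Nonempty (ReducedSort M I s) :=
  ⟨ReducedSort.mk I fun j => Classical.choice ((M j).nonempty s)⟩

/-- The reduced product of the `M j` modulo `I`. -/
def reducedProduct (M : ι → MetricStructure.{u, v} L) (I : Order.Ideal (Set ι)) [I.IsProper] :
    MetricStructure.{u, max w v} L where
  carrier s := ReducedSort M I s
  metric _ := inferInstance
  nonempty _ := inferInstance
  dist_le _ := ReducedSort.dist_le
  fn := reducedFn M I
  fn_unif f _ hε _ _ h := dist_reducedFn_le f hε h
  rel := reducedRel M I
  rel_mem := reducedRel_mem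
  rel_unif R _ hε _ _ h := abs_reducedRel_sub_le R hε h

end

/-! ## The two-layered language and the structure `(∏ M j / I, ∏ M j / J, π)` -/

/-- The two meta-sorts: `fine` for the reduced product modulo the smaller ideal, `coarse` for the
reduced product modulo the larger ideal. -/
inductive Layer
  | fine
  | coarse

/-- The function symbols of the two-layered language: a copy of every function symbol of `L` in
each layer, and for every sort `s` of `L` a symbol for the quotient map. -/
inductive PairFunc (L : MetricLanguage.{u}) : Type u
  | base (b : Layer) (f : L.Func) : PairFunc L
  | proj (s : L.Sorts) : PairFunc L

def PairFunc.arity : PairFunc L → ℕ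
  | base _ f => L.funArity f
  | proj _ => 1

def PairFunc.dom : ∀ F : PairFunc L, Fin F.arity → L.Sorts × Layer
  | base b f, i => (L.funDom f i, b)
  | proj s, _ => (s, .fine)

def PairFunc.cod : PairFunc L → L.Sorts × Layer
  | base b f => (L.funCod f, b)
  | proj s => (s, .coarse)

/-- The quotient maps are 1-Lipschitz: their modulus is the identity. -/
def PairFunc.mod : PairFunc L → ℝ → ℝ
  | base _ f => L.funMod f
  | proj _ => id

/-- The language of structures consisting of two `L`-structures and maps from the sorts of the
first to the sorts of the second. -/
def MetricLanguage.pair (L : MetricLanguage.{u}) : MetricLanguage.{u} where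
  Sorts := L.Sorts × Layer
  diam p := L.diam p.1
  Func := PairFunc L
  funArity := PairFunc.arity
  funDom := PairFunc.dom
  funCod := PairFunc.cod
  funMod := PairFunc.mod
  funMod_pos := by
    rintro (⟨b, f⟩ | s) ε hε
    · exact L.funMod_pos f ε hε
    · exact hε
  Rel := Layer × L.Rel
  relArity R := L.relArity R.2
  relDom R i := (L.relDom R.2 i, R.1)
  relLo R := L.relLo R.2
  relHi R := L.relHi R.2
  relLo_le_relHi R := L.relLo_le_relHi R.2
  relMod R := L.relMod R.2
  relMod_pos R := L.relMod_pos R.2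

section Pair

/-- The ideal that belongs to a layer. -/
def layerIdeal (I J : Order.Ideal (Set ι)) : Layer → Order.Ideal (Set ι)
  | .fine => I
  | .coarse => J

instance (I J : Order.Ideal (Set ι)) [hI : I.IsProper] [hJ : J.IsProper] (b : Layer) :
    (layerIdeal I J b).IsProper :=
  match b with
  | .fine => hI
  | .coarse => hJ

variable {M : ι → MetricStructure.{u, v} L} {I J : Order.Ideal (Set ι)} [hI : I.IsProper]
  [hJ : J.IsProper]

/-- The quotient map from the reduced product modulo `I` to the one modulo `J`. -/
def reducedProj (J : Order.Ideal (Set ι)) [J.IsProper] {s : L.Sorts} (p : ReducedSort M I s) :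
    ReducedSort M J s :=
  ReducedSort.mk J p.rep

theorem dist_reducedProj_le (hIJ : I ≤ J) {s : L.Sorts} (p q : ReducedSort M I s) :
    dist (reducedProj J p) (reducedProj J q) ≤ dist p q := by
  rw [ReducedSort.dist_eq p q]
  exact limsupAlong_anti hJ hIJ fun j => dist_mem_Icc (M j) _ _

/-- The quotient map sends the class of a sequence modulo `I` to its class modulo `J`. -/
theorem reducedProj_mk (hIJ : I ≤ J) {s : L.Sorts} (a : ∀ j, (M j).carrier s) :
    reducedProj J (ReducedSort.mk I a) = ReducedSort.mk J a := by
  refine dist_le_zero.1 ((limsupAlong_anti hJ hIJ fun j => dist_mem_Icc (M j) _ _).trans ?_)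
  rw [← ReducedSort.dist_mk, ReducedSort.mk_rep, dist_self]

/-- The interpretation of the function symbols of the two-layered language. -/
def pairFn (M : ι → MetricStructure.{u, v} L) (I J : Order.Ideal (Set ι)) [I.IsProper]
    [J.IsProper] :
    ∀ F : PairFunc L, (∀ i, ReducedSort M (layerIdeal I J (F.dom i).2) (F.dom i).1) →
      ReducedSort M (layerIdeal I J F.cod.2) F.cod.1
  | .base b f, p => reducedFn M (layerIdeal I J b) f p
  | .proj _, p => reducedProj (I := I) J (p (0 : Fin 1))

/-- The structure `(∏ M j / I, ∏ M j / J, π)`, where `π` is the quotient map. -/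
def pairStructure (M : ι → MetricStructure.{u, v} L) (I J : Order.Ideal (Set ι)) [I.IsProper]
    [J.IsProper] (hIJ : I ≤ J) : MetricStructure.{u, max w v} L.pair where
  carrier p := ReducedSort M (layerIdeal I J p.2) p.1
  metric _ := inferInstance
  nonempty _ := inferInstance
  dist_le _ := ReducedSort.dist_le
  fn := pairFn M I J
  fn_unif := by
    rintro (⟨b, f⟩ | s) ε hε p q h
    · exact dist_reducedFn_le (M := M) (I := layerIdeal I J b) f hε h
    · exact (dist_reducedProj_le hIJ _ _).trans (h (0 : Fin 1)).le
  rel R p := reducedRel M (layerIdeal I J R.1) R.2 p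
  rel_mem R p := reducedRel_mem (M := M) (I := layerIdeal I J R.1) R.2 p
  rel_unif R _ hε p q h :=
    abs_reducedRel_sub_le (M := M) (I := layerIdeal I J R.1) R.2 hε (p := p) (q := q) h

end Pair

end ReducedProduct

/-! ## Boolean algebras with a distinguished predicate -/

section Boolean

/-- The operations of Boolean algebras. -/
inductive BAFunc : ℕ → Type
  | bot : BAFunc 0
  | top : BAFunc 0
  | compl : BAFunc 1
  | inf : BAFunc 2
  | sup : BAFunc 2

/-- The additional unary predicate. -/
inductive BARel : ℕ → Type
  | U : BARel 1

/-- The first-order language of Boolean algebras with an additional unary predicate. -/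
def baLang : FirstOrder.Language where
  Functions := BAFunc
  Relations := BARel

/-- A Boolean algebra `B` as a structure for `baLang`, where the additional predicate is
interpreted as the complement of the ideal `K`. -/
@[reducible]
def baStructure (B : Type x) [BooleanAlgebra B] (K : Order.Ideal B) : baLang.Structure B where
  funMap := fun F z => match F, z with
    | .bot, _ => ⊥
    | .top, _ => ⊤
    | .compl, z => (z 0)ᶜ
    | .inf, z => z 0 ⊓ z 1
    | .sup, z => z 0 ⊔ z 1
  RelMap := fun R z => match R, z with
    | .U, z => z 0 ∉ K

/-- Truth of `θ` in the Boolean algebra `B` with predicate the complement of `K`, where the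
constants (elements of `C`) that occur in `θ` are interpreted by `z`. -/
def BAHolds {C : Type*} (B : Type x) [BooleanAlgebra B] (K : Order.Ideal B) (θ : baLang.Formula C)
    (z : C → B) : Prop :=
  letI := baStructure B K
  θ.Realize z

/-- `θ` is increasing in its constants. -/
def BAIncreasing {C : Type*} (θ : baLang.Formula C) : Prop :=
  ∀ (B : Type x) [BooleanAlgebra B] (K : Order.Ideal B) (z z' : C → B),
    (∀ c, z c ≤ z' c) → BAHolds B K θ z → BAHolds B K θ z'

variable {ι : Type w} (I : Order.Ideal (Set ι))

theorem mem_ideal_of_subset {X Y : Set ι} (hY : Y ∈ I) (h : X ⊆ Y) : X ∈ I := I.lower h hY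

theorem mem_ideal_of_subset_union {X Y Z : Set ι} (hY : Y ∈ I) (hZ : Z ∈ I) (h : X ⊆ Y ∪ Z) :
    X ∈ I := I.lower h (Order.Ideal.sup_mem hY hZ)

/-- Sets are identified when their symmetric difference is in the ideal. -/
def idealSetoid : Setoid (Set ι) where
  r X Y := symmDiff X Y ∈ I
  iseqv :=
    { refl X := by simpa using I.bot_mem
      symm {X Y} h := by rwa [symmDiff_comm]
      trans {X Y Z} h h' := mem_ideal_of_subset_union I h h' (symmDiff_triangle X Y Z) }

/-- The quotient of the power set of `ι` modulo the ideal `I`. -/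
def PowerQuot : Type w := Quotient (idealSetoid I)

/-- The class of a set modulo `I`. -/
def PowerQuot.mk (X : Set ι) : PowerQuot I := Quotient.mk (idealSetoid I) X

namespace PowerQuot

theorem mk_eq_iff {X Y : Set ι} : mk I X = mk I Y ↔ symmDiff X Y ∈ I :=
  Quotient.eq (r := idealSetoid I)

theorem mk_eq_iff' {X Y : Set ι} : mk I X = mk I Y ↔ X \ Y ∈ I ∧ Y \ X ∈ I := by
  rw [mk_eq_iff]
  exact Order.Ideal.sup_mem_iff

theorem mk_surjective : Function.Surjective (mk I) := Quotient.exists_rep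

def compl : PowerQuot I → PowerQuot I :=
  Quotient.map' (fun X => Xᶜ) fun X Y h => by
    have h' : symmDiff X Y ∈ I := h
    have e : symmDiff Xᶜ Yᶜ = symmDiff X Y := compl_symmDiff_compl X Y
    change symmDiff Xᶜ Yᶜ ∈ I
    rwa [e]

def inf : PowerQuot I → PowerQuot I → PowerQuot I :=
  Quotient.map₂ (fun X Y => X ∩ Y) fun X X' h Y Y' h' =>
    mem_ideal_of_subset_union I h h' fun j hj => by
      simp only [Set.mem_symmDiff, Set.mem_inter_iff, Set.mem_union] at hj ⊢
      tauto

def sup : PowerQuot I → PowerQuot I → PowerQuot I :=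
  Quotient.map₂ (fun X Y => X ∪ Y) fun X X' h Y Y' h' =>
    mem_ideal_of_subset_union I h h' fun j hj => by
      simp only [Set.mem_symmDiff, Set.mem_union] at hj ⊢
      tauto

def le (p q : PowerQuot I) : Prop := inf I p q = p

theorem le_mk {X Y : Set ι} : le I (mk I X) (mk I Y) ↔ X \ Y ∈ I := by
  have : inf I (mk I X) (mk I Y) = mk I (X ∩ Y) := rfl
  rw [le, this, mk_eq_iff']
  have h1 : (X ∩ Y) \ X = ∅ := by ext; simp; tauto
  have h2 : X \ (X ∩ Y) = X \ Y := by ext; simp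
  rw [h1, h2]
  exact and_iff_right I.bot_mem

instance : BooleanAlgebra (PowerQuot I) where
  le := le I
  inf := inf I
  sup := sup I
  compl := compl I
  top := mk I univ
  bot := mk I ∅
  le_refl p := by
    obtain ⟨X, rfl⟩ := mk_surjective I p
    rw [le_mk, Set.sdiff_self]; exact I.bot_mem
  le_trans p q r := by
    obtain ⟨X, rfl⟩ := mk_surjective I p
    obtain ⟨Y, rfl⟩ := mk_surjective I q
    obtain ⟨Z, rfl⟩ := mk_surjective I r
    rw [le_mk, le_mk, le_mk]
    intro h h'
    refine mem_ideal_of_subset_union I h h' fun j hj => ?_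
    simp only [Set.mem_sdiff, Set.mem_union] at hj ⊢
    tauto
  le_antisymm p q := by
    obtain ⟨X, rfl⟩ := mk_surjective I p
    obtain ⟨Y, rfl⟩ := mk_surjective I q
    rw [le_mk, le_mk, mk_eq_iff']
    exact And.intro
  le_sup_left p q := by
    obtain ⟨X, rfl⟩ := mk_surjective I p
    obtain ⟨Y, rfl⟩ := mk_surjective I q
    exact (le_mk I).2 (mem_ideal_of_subset I I.bot_mem fun j hj => hj.2 (Or.inl hj.1))
  le_sup_right p q := by
    obtain ⟨X, rfl⟩ := mk_surjective I p
    obtain ⟨Y, rfl⟩ := mk_surjective I q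
    exact (le_mk I).2 (mem_ideal_of_subset I I.bot_mem fun j hj => hj.2 (Or.inr hj.1))
  sup_le p q r := by
    obtain ⟨X, rfl⟩ := mk_surjective I p
    obtain ⟨Y, rfl⟩ := mk_surjective I q
    obtain ⟨Z, rfl⟩ := mk_surjective I r
    rw [le_mk, le_mk]
    intro h h'
    refine (le_mk I).2 (mem_ideal_of_subset_union I h h' fun j hj => ?_)
    simp only [Set.mem_sdiff, Set.mem_union] at hj ⊢
    tauto
  inf_le_left p q := by
    obtain ⟨X, rfl⟩ := mk_surjective I p
    obtain ⟨Y, rfl⟩ := mk_surjective I q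
    exact (le_mk I).2 (mem_ideal_of_subset I I.bot_mem fun j hj => hj.2 hj.1.1)
  inf_le_right p q := by
    obtain ⟨X, rfl⟩ := mk_surjective I p
    obtain ⟨Y, rfl⟩ := mk_surjective I q
    exact (le_mk I).2 (mem_ideal_of_subset I I.bot_mem fun j hj => hj.2 hj.1.2)
  le_inf p q r := by
    obtain ⟨X, rfl⟩ := mk_surjective I p
    obtain ⟨Y, rfl⟩ := mk_surjective I q
    obtain ⟨Z, rfl⟩ := mk_surjective I r
    rw [le_mk, le_mk]
    intro h h'
    refine (le_mk I).2 (mem_ideal_of_subset_union I h h' fun j hj => ?_)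
    simp only [Set.mem_sdiff, Set.mem_union, Set.mem_inter_iff] at hj ⊢
    tauto
  le_sup_inf p q r := by
    obtain ⟨X, rfl⟩ := mk_surjective I p
    obtain ⟨Y, rfl⟩ := mk_surjective I q
    obtain ⟨Z, rfl⟩ := mk_surjective I r
    refine (le_mk I).2 (mem_ideal_of_subset I I.bot_mem fun j hj => hj.2 ?_)
    have := hj.1
    simp only [Set.mem_union, Set.mem_inter_iff] at this ⊢
    tauto
  inf_compl_le_bot p := by
    obtain ⟨X, rfl⟩ := mk_surjective I p
    exact (le_mk I).2 (mem_ideal_of_subset I I.bot_mem fun j hj => hj.1.2 hj.1.1)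
  top_le_sup_compl p := by
    obtain ⟨X, rfl⟩ := mk_surjective I p
    exact (le_mk I).2 (mem_ideal_of_subset I I.bot_mem fun j hj => hj.2 (Classical.em _))
  le_top p := by
    obtain ⟨X, rfl⟩ := mk_surjective I p
    exact (le_mk I).2 (mem_ideal_of_subset I I.bot_mem fun j hj => hj.2 trivial)
  bot_le p := by
    obtain ⟨X, rfl⟩ := mk_surjective I p
    exact (le_mk I).2 (mem_ideal_of_subset I I.bot_mem fun j hj => hj.1)

theorem mk_le_mk {X Y : Set ι} : mk I X ≤ mk I Y ↔ X \ Y ∈ I := le_mk I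

/-- The ideal `J / I` of the quotient modulo `I`, consisting of the classes of elements of `J`. -/
def idealMap (J : Order.Ideal (Set ι)) : Order.Ideal (PowerQuot I) where
  carrier := mk I '' (J : Set (Set ι))
  lower' := by
    rintro _ q h ⟨X, hX, rfl⟩
    obtain ⟨Y, rfl⟩ := mk_surjective I q
    rw [mk_le_mk] at h
    refine ⟨Y ∩ X, J.lower Set.inter_subset_right hX, ?_⟩
    rw [mk_eq_iff']
    have h1 : (Y ∩ X) \ Y = ∅ := by ext; simp; tauto
    have h2 : Y \ (Y ∩ X) = Y \ X := by ext; simp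
    rw [h1, h2]
    exact ⟨I.bot_mem, h⟩
  nonempty' := ⟨_, ⊥, J.bot_mem, rfl⟩
  directed' := by
    rintro _ ⟨X, hX, rfl⟩ _ ⟨Y, hY, rfl⟩
    exact ⟨mk I (X ∪ Y), ⟨_, Order.Ideal.sup_mem hX hY, rfl⟩,
      le_sup_left (a := mk I X) (b := mk I Y), le_sup_right (a := mk I X) (b := mk I Y)⟩

theorem mk_mem_idealMap {J : Order.Ideal (Set ι)} (hIJ : I ≤ J) {X : Set ι} :
    mk I X ∈ idealMap I J ↔ X ∈ J := by
  refine ⟨?_, fun h => ⟨X, h, rfl⟩⟩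
  rintro ⟨Y, hY, h⟩
  refine mem_ideal_of_subset_union J hY (hIJ ((mk_eq_iff' I).1 h).2) fun j hj => ?_
  by_cases hjY : j ∈ Y
  · exact Or.inl hjY
  · exact Or.inr ⟨hj, hjY⟩

end PowerQuot

end Boolean

/-! ## Determined formulas -/

/-- A formula `φ` of the two-layered language is `k`-determined if there are a finite set `F` of
`L`-formulas whose free variables are among those of `φ`, and sentences `θ 0, …, θ k` in the
language of Boolean algebras with an additional predicate and with constants `Z ζ t` for `ζ ∈ F`
and rational `t ∈ [0, 1]`, such that every `θ l` is increasing, and in all structures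
`(∏ M j / I, ∏ M j / J, π)` the value of `φ` exceeds `(l - 1) / k` if `θ l` holds, and `θ l` holds
if the value of `φ` exceeds `(l + 1) / k`. Here `θ l` is evaluated in `P(ι) / I`, with `Z ζ t`
interpreted as the class of `{j | ζ(a j) > t}` and the additional predicate as not belonging to
`J / I`.

A variable `x` of `φ` has a sort `(σ x).1` of `L` and a layer `(σ x).2`; as a variable of an
`L`-formula it has the sort `(σ x).1`. -/
def IsDetermined {L : MetricLanguage.{u}} {V : Type y} {σ : V → L.Sorts × Layer} (k : ℕ)
    (φ : Formula L.pair σ) : Prop :=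
  ∃ (F : Finset (Formula L fun x => (σ x).1))
    (θ : Fin (k + 1) → baLang.Formula (F × Icc (0 : ℚ) 1)),
    (∀ ζ ∈ F, ζ.freeVars ⊆ φ.freeVars) ∧
    (∀ l, BAIncreasing.{x} (θ l)) ∧
    ∀ (ι : Type w) (M : ι → MetricStructure.{u, v} L) (I J : Order.Ideal (Set ι))
      [I.IsProper] [J.IsProper] (hIJ : I ≤ J) (a : ∀ x, ∀ j, (M j).carrier (σ x).1)
      (l : Fin (k + 1)),
      let value : ℝ := φ.eval (pairStructure M I J hIJ)
        (fun x => ReducedSort.mk (layerIdeal I J (σ x).2) (a x))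
      let Z : F × Icc (0 : ℚ) 1 → PowerQuot I := fun c =>
        PowerQuot.mk I {j | ((c.2 : ℚ) : ℝ) < (c.1 : Formula L fun x => (σ x).1).eval (M j)
          (fun x => a x j)}
      let holds : Prop := BAHolds (PowerQuot I) (PowerQuot.idealMap I J) (θ l) Z
      (((l : ℕ) + 1 : ℝ) / k < value → holds) ∧ (holds → ((l : ℕ) - 1 : ℝ) / k < value)

end ContLogic

end

/-! This is a Feferman–Vaught argument that leaves room for error. By induction on `φ`, for all
reals `r < s` the conditions `s ≤ φ` and `r < φ` are separated (`Separable`) by one increasing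
sentence `θ`: the first implies `θ` at the sets `{ζ i ≥ 1}`, and `θ` at the larger sets `{ζ i > 0}`
implies the second. The sets `Z ζ 0 = {ζ > 0}` contain the sets `{ζ ≥ 1}`, so for increasing `θ` the
theorem is the case `r = (l - 1) / k`, `s = (l + 1) / k` of `separable_value`.

Atomic formulas: quotient maps do not change representing sequences, so the value is an upper limit,
along one of the two ideals, of an atomic `L`-formula. An upper limit is large when the set of
indices with large value is outside the ideal, that is, when its class is nonzero or satisfies `U`
(`separable_limsupAlong`).

Connectives: the values lie in a compact box, and finitely many small balls in it reduce a bound on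
`f` to bounds on its arguments (`separable_continuous`).

Quantifiers (`Separable.exists_update`, the heart of the proof): a sequence `b` is chosen one index
at a time. Sets `Y i` lie in `{ζ i(b) > 0}` modulo `I` for some `b` exactly when, for every finite
set `S` of labels and almost every index in `⋂ i ∈ S, Y i`, a single element makes all `ζ i` with `i
∈ S` positive. This is a condition on the `L`-formula `sup_x min_{i ∈ S} ζ i`, so quantification
over sequences becomes quantification over the Boolean algebra. Infima reduce to suprema by
negation: `ζ` becomes `1 - ζ` and `θ(z)` becomes `¬ θ(zᶜ)`, which is again increasing. -/

noncomputable section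

open Set

namespace ContLogic

/-! ## Formulas in the language of Boolean algebras -/

section BooleanFormulas

variable {C D : Type} {B : Type x} [BooleanAlgebra B] {K : Order.Ideal B}

/-- The complement of a term. -/
def baCompl (t : baLang.Term C) : baLang.Term C :=
  FirstOrder.Language.Term.func (L := baLang) (l := 1) BAFunc.compl ![t]

/-- The meet of two terms. -/
def baInf (t t' : baLang.Term C) : baLang.Term C :=
  FirstOrder.Language.Term.func (L := baLang) (l := 2) BAFunc.inf ![t, t']

/-- The least element, as a term. -/
def baBot : baLang.Term C :=
  FirstOrder.Language.Term.func (L := baLang) (l := 0) BAFunc.bot ![]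

/-- The greatest element, as a term. -/
def baTop : baLang.Term C :=
  FirstOrder.Language.Term.func (L := baLang) (l := 0) BAFunc.top ![]

/-- The meet of a finite set of variables. -/
def baFinsetInf (S : Finset C) : baLang.Term C :=
  (S.toList.map FirstOrder.Language.Term.var).foldr baInf baTop

theorem realize_baCompl (t : baLang.Term C) (z : C → B) :
    letI := baStructure B K
    (baCompl t).realize z = (t.realize z)ᶜ := rfl

theorem realize_baInf (t t' : baLang.Term C) (z : C → B) :
    letI := baStructure B K
    (baInf t t').realize z = t.realize z ⊓ t'.realize z := rfl

theorem realize_baFinsetInf (S : Finset C) (z : C → B) :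
    letI := baStructure B K
    (baFinsetInf S).realize z = S.inf z := by
  let _ := baStructure B K
  have key : ∀ l : List C, ((l.map FirstOrder.Language.Term.var).foldr baInf baTop :
      baLang.Term C).realize z = (l.map z).foldr (· ⊓ ·) ⊤ := by
    intro l
    induction l with
    | nil => rfl
    | cons i l ih =>
      simp only [List.map_cons, List.foldr_cons, ← ih]
      rfl
  have h : S.inf z = (S.toList.map z).foldr (· ⊓ ·) ⊤ := by
    rw [Finset.inf_def, ← Finset.coe_toList, Multiset.map_coe, Multiset.inf, Multiset.coe_fold_r]
  rw [h, baFinsetInf, key]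

theorem baHolds_top (z : C → B) : BAHolds B K ⊤ z := by
  let _ := baStructure B K
  exact FirstOrder.Language.Formula.realize_top.2 trivial

theorem baHolds_relabel (θ : baLang.Formula C) {D : Type*} (g : C → D) (z : D → B) :
    BAHolds B K (θ.relabel g) z ↔ BAHolds B K θ (z ∘ g) := by
  let _ := baStructure B K
  exact FirstOrder.Language.Formula.realize_relabel

theorem BAIncreasing.relabel {θ : baLang.Formula C} (hθ : BAIncreasing.{x} θ) {D : Type*}
    (g : C → D) : BAIncreasing.{x} (θ.relabel g) := fun B _ K z z' h => by
  rw [baHolds_relabel, baHolds_relabel]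
  exact hθ B K _ _ fun c => h (g c)

/-- The formula `¬ θ(zᶜ)`. -/
def baDual (θ : baLang.Formula C) : baLang.Formula C :=
  (FirstOrder.Language.BoundedFormula.subst θ
    fun c => baCompl (FirstOrder.Language.Term.var c)).not

theorem baHolds_baDual (θ : baLang.Formula C) (z : C → B) :
    BAHolds B K (baDual θ) z ↔ ¬ BAHolds B K θ fun c => (z c)ᶜ := by
  let _ := baStructure B K
  exact FirstOrder.Language.BoundedFormula.realize_not.trans
    (not_congr FirstOrder.Language.BoundedFormula.realize_subst)

theorem BAIncreasing.baDual {θ : baLang.Formula C} (hθ : BAIncreasing.{x} θ) :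
    BAIncreasing.{x} (baDual θ) := fun B _ K z z' h => by
  rw [baHolds_baDual, baHolds_baDual]
  exact mt (hθ B K _ _ fun c => compl_le_compl (h c))

/-- The conjunction of two formulas with disjoint variables. -/
def baAnd (θ : baLang.Formula C) (θ' : baLang.Formula D) : baLang.Formula (C ⊕ D) :=
  θ.relabel Sum.inl ⊓ θ'.relabel Sum.inr

theorem baHolds_baAnd (θ : baLang.Formula C) (θ' : baLang.Formula D) (z : C ⊕ D → B) :
    BAHolds B K (baAnd θ θ') z ↔
      BAHolds B K θ (z ∘ Sum.inl) ∧ BAHolds B K θ' (z ∘ Sum.inr) := by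
  rw [← baHolds_relabel, ← baHolds_relabel]
  let _ := baStructure B K
  exact FirstOrder.Language.Formula.realize_inf

theorem BAIncreasing.baAnd {θ : baLang.Formula C} {θ' : baLang.Formula D}
    (hθ : BAIncreasing.{x} θ) (hθ' : BAIncreasing.{x} θ') :
    BAIncreasing.{x} (baAnd θ θ') := fun B _ K z z' h => by
  rw [baHolds_baAnd, baHolds_baAnd]
  exact And.imp (hθ B K _ _ fun c => h _) (hθ' B K _ _ fun c => h _)

/-- The formula expressing that the value of a variable is not zero. -/
def baNonzero : baLang.Formula Unit :=
  (FirstOrder.Language.Term.equal (FirstOrder.Language.Term.var ()) baBot).not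

theorem baHolds_baNonzero (z : Unit → B) : BAHolds B K baNonzero z ↔ z () ≠ ⊥ := by
  let _ := baStructure B K
  exact FirstOrder.Language.BoundedFormula.realize_not.trans
    (not_congr FirstOrder.Language.Formula.realize_equal)

/-- The formula expressing that the predicate holds of the value of a variable. -/
def baU : baLang.Formula Unit :=
  FirstOrder.Language.Relations.formula (L := baLang) (n := 1) BARel.U
    ![FirstOrder.Language.Term.var ()]

theorem baHolds_baU (z : Unit → B) : BAHolds B K baU z ↔ z () ∉ K := by
  let _ := baStructure B K
  exact FirstOrder.Language.Formula.realize_rel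

theorem baIncreasing_baNonzero : BAIncreasing.{x} baNonzero := fun B _ K z z' h => by
  rw [baHolds_baNonzero, baHolds_baNonzero]
  exact mt fun h' => le_bot_iff.1 (h' ▸ h ())

theorem baIncreasing_baU : BAIncreasing.{x} baU := fun B _ K z z' h => by
  rw [baHolds_baU, baHolds_baU]
  exact mt fun h' => K.lower (h ()) h'

variable [Finite C]

/-- The formula expressing that `θ` holds of some tuple `Y` such that `⋂ i ∈ S, Y i` is contained
in the value of the variable `S`, for every `S`. -/
def baExists (θ : baLang.Formula C) : baLang.Formula (Finset C) :=
  FirstOrder.Language.Formula.iExs C (θ.relabel Sum.inr ⊓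
    FirstOrder.Language.Formula.iInf fun S : Finset C =>
      FirstOrder.Language.Term.equal
        (baInf ((baFinsetInf S).relabel Sum.inr)
          (baCompl (FirstOrder.Language.Term.var (Sum.inl S)))) baBot)

theorem baHolds_baExists (θ : baLang.Formula C) (z : Finset C → B) :
    BAHolds B K (baExists θ) z ↔
      ∃ Y : C → B, BAHolds B K θ Y ∧ ∀ S : Finset C, S.inf Y ≤ z S := by
  let _ := baStructure B K
  refine FirstOrder.Language.BoundedFormula.realize_iExs.trans (exists_congr fun Y => ?_)
  refine FirstOrder.Language.Formula.realize_inf.trans (and_congr ?_ ?_)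
  · exact FirstOrder.Language.Formula.realize_relabel
  · refine FirstOrder.Language.Formula.realize_iInf.trans (forall_congr' fun S => ?_)
    refine FirstOrder.Language.Formula.realize_equal.trans ?_
    rw [realize_baInf, FirstOrder.Language.Term.realize_relabel, realize_baFinsetInf,
      realize_baCompl]
    change _ ⊓ (z S)ᶜ = ⊥ ↔ _
    -- The order is not a symbol of the language; `p ≤ q` is expressed by `p ⊓ qᶜ = ⊥`.
    rw [← disjoint_iff, disjoint_compl_right_iff]
    rfl

/-- The constants occur only as upper bounds for meets of the quantified `Y`, so nothing is required
of `θ`. -/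
theorem baIncreasing_baExists (θ : baLang.Formula C) :
    BAIncreasing.{x} (baExists θ) := fun B _ K z z' h => by
  rw [baHolds_baExists, baHolds_baExists]
  exact fun ⟨Y, hY, hS⟩ => ⟨Y, hY, fun S => (hS S).trans (h S)⟩

end BooleanFormulas

/-! ## Separable pairs of properties of sequences in families of structures -/

set_option linter.checkUnivs false in
/-- A family of structures with two ideals and an assignment of the variables in the product. -/
structure Context (L : MetricLanguage.{u}) {V : Type y} (σ : V → L.Sorts × Layer) where
  ι : Type w
  M : ι → MetricStructure.{u, v} L
  I : Order.Ideal (Set ι)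
  J : Order.Ideal (Set ι)
  [hI : I.IsProper]
  [hJ : J.IsProper]
  le : I ≤ J
  seq : ∀ x, ∀ j, (M j).carrier (σ x).1

attribute [instance] Context.hI Context.hJ

section Separable

variable {L : MetricLanguage.{u}} {V : Type y} {σ : V → L.Sorts × Layer}

/-- The formulas of `L` in the variables of a formula of the two-layered language. -/
abbrev BaseFormula {L : MetricLanguage.{u}} {V : Type y} (σ : V → L.Sorts × Layer) :=
  Formula L fun x => (σ x).1

namespace Context

/-- The values of the variables in the structure with index `j`. -/
def at' (c : Context.{u, v, w} L σ) (j : c.ι) (x : V) : (c.M j).carrier (σ x).1 := c.seq x j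

open Classical in
/-- Replace the sequence assigned to `x` by `b`. -/
def update (c : Context.{u, v, w} L σ) (x : V) (b : ∀ j, (c.M j).carrier (σ x).1) :
    Context.{u, v, w} L σ :=
  { c with seq := Function.update c.seq x b }

/-- The value of a formula of the two-layered language. -/
def value (c : Context.{u, v, w} L σ) (φ : Formula L.pair σ) : ℝ :=
  φ.eval (pairStructure c.M c.I c.J c.le)
    (fun x => ReducedSort.mk (layerIdeal c.I c.J (σ x).2) (c.seq x))

/-- The set of indices where the value of `ζ` is in `T`. -/
def region (c : Context.{u, v, w} L σ) (T : Set ℝ) (ζ : BaseFormula σ) : Set c.ι :=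
  {j | ζ.eval (c.M j) (c.at' j) ∈ T}

/-- Truth of `θ` in the power set modulo the smaller ideal, when the constants are interpreted by
the classes of the sets `Z i`. -/
def Holds (c : Context.{u, v, w} L σ) {C : Type*} (θ : baLang.Formula C) (Z : C → Set c.ι) :
    Prop :=
  BAHolds (PowerQuot c.I) (PowerQuot.idealMap c.I c.J) θ fun i => PowerQuot.mk c.I (Z i)

open Classical in
theorem update_at' (c : Context.{u, v, w} L σ) (x : V) (b : ∀ j, (c.M j).carrier (σ x).1)
    (j : c.ι) : (c.update x b).at' j = Function.update (c.at' j) x (b j) := by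
  funext y
  by_cases h : y = x
  · subst h
    simp [at', update]
  · simp [at', update, h]

open Classical in
theorem mem_region_update {c : Context.{u, v, w} L σ} {x : V}
    {b : ∀ j, (c.M j).carrier (σ x).1} {T : Set ℝ} {ζ : BaseFormula σ} {j : c.ι} :
    j ∈ (c.update x b).region T ζ ↔
      ζ.eval (c.M j) (Function.update (c.at' j) x (b j)) ∈ T := by
  rw [← update_at']
  rfl

theorem Holds.mono {c : Context.{u, v, w} L σ} {C : Type*} {θ : baLang.Formula C}
    (hθ : BAIncreasing.{w} θ) {Z Z' : C → Set c.ι} (h : ∀ i, Z i \ Z' i ∈ c.I)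
    (hZ : c.Holds θ Z) : c.Holds θ Z' :=
  hθ _ _ _ _ (fun i => (PowerQuot.mk_le_mk c.I).2 (h i)) hZ

end Context

/-- The property `P` implies an increasing sentence that implies `Q`, where the constants of the
sentence are interpreted by `{1 ≤ ζ i}` and by `{0 < ζ i}`, respectively, for finitely many
formulas `ζ i` with free variables in `W`. -/
def Separable (W : Set V) (P Q : Context.{u, v, w} L σ → Prop) : Prop :=
  ∃ (C : Type) (_ : Finite C) (ζ : C → BaseFormula σ) (θ : baLang.Formula C),
    -- Monotonicity at universe `w` is applied in the algebras `P(ι) / I`; at universe `x` it is the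
    -- one that `IsDetermined` demands.
    (∀ i, (ζ i).freeVars ⊆ W) ∧ BAIncreasing.{w} θ ∧ BAIncreasing.{x} θ ∧
    ∀ c, (P c → c.Holds θ fun i => c.region (Ici 1) (ζ i)) ∧
      (c.Holds θ (fun i => c.region (Ioi 0) (ζ i)) → Q c)

/-- The composition of a formula with a continuous function of one variable. -/
def Formula.comp {τ : V → L.Sorts} (f : C(ℝ, ℝ)) (ζ : Formula L τ) : Formula L τ :=
  .conn 1 ⟨fun v => f (v 0), by fun_prop⟩ fun _ => ζ

theorem Formula.eval_comp {τ : V → L.Sorts} (f : C(ℝ, ℝ)) (ζ : Formula L τ)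
    (M : MetricStructure.{u, v} L) (a : ∀ x, M.carrier (τ x)) :
    (ζ.comp f).eval M a = f (ζ.eval M a) := rfl

theorem Formula.freeVars_comp {τ : V → L.Sorts} (f : C(ℝ, ℝ)) (ζ : Formula L τ) :
    (ζ.comp f).freeVars = ζ.freeVars := by
  exact iUnion_const _

/-! ### Closure of separability under Boolean operations -/

namespace Separable

variable {W W' : Set V} {P P' Q Q' : Context.{u, v, w} L σ → Prop}

theorem mono (h : Separable.{u, v, w, x} W P Q) (hW : W ⊆ W') (hP : ∀ c, P' c → P c)
    (hQ : ∀ c, Q c → Q' c) : Separable.{u, v, w, x} W' P' Q' := by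
  obtain ⟨C, hC, ζ, θ, hζ, hw, hx, h⟩ := h
  exact ⟨C, hC, ζ, θ, fun i => (hζ i).trans hW, hw, hx,
    fun c => ⟨fun hc => (h c).1 (hP c hc), fun hc => hQ c ((h c).2 hc)⟩⟩

/-- Replacing `ζ` by `1 - ζ` exchanges the two thresholds: the complement of `{1 - ζ ≥ 1}` is `{ζ >
0}`, and that of `{1 - ζ > 0}` is `{ζ ≥ 1}`. Hence the contrapositives of the two implications are
the ones needed for the dual sentence. -/
theorem not (h : Separable.{u, v, w, x} W P Q) :
    Separable.{u, v, w, x} W (fun c => ¬ Q c) (fun c => ¬ P c) := by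
  obtain ⟨C, hC, ζ, θ, hζ, hw, hx, h⟩ := h
  let f : C(ℝ, ℝ) := ⟨fun t => 1 - t, by fun_prop⟩
  refine ⟨C, hC, fun i => (ζ i).comp f, baDual θ,
    fun i => (Formula.freeVars_comp f (ζ i)).trans_subset (hζ i), hw.baDual, hx.baDual,
    fun c => ⟨fun hQ => ?_, fun hθ hP => ?_⟩⟩
  · refine (baHolds_baDual θ _).2 fun hθ => hQ ((h c).2 ?_)
    refine Context.Holds.mono (Z := fun i => (c.region (Ici 1) ((ζ i).comp f))ᶜ) hw
      (fun i => mem_ideal_of_subset c.I c.I.bot_mem ?_) hθ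
    rintro j ⟨hj, hj'⟩
    simp only [Context.region, mem_compl_iff, mem_ofPred_eq, Formula.eval_comp, mem_Ici,
      mem_Ioi, f, ContinuousMap.coe_mk] at hj hj'
    exact hj (by linarith)
  · refine (baHolds_baDual θ _).1 hθ ?_
    refine Context.Holds.mono (Z' := fun i => (c.region (Ioi 0) ((ζ i).comp f))ᶜ) hw
      (fun i => mem_ideal_of_subset c.I c.I.bot_mem ?_) ((h c).1 hP)
    rintro j ⟨hj, hj'⟩
    simp only [Context.region, mem_compl_iff, mem_ofPred_eq, Formula.eval_comp, mem_Ici,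
      mem_Ioi, f, ContinuousMap.coe_mk] at hj hj'
    exact hj' (by linarith)

theorem and (h : Separable.{u, v, w, x} W P Q) (h' : Separable.{u, v, w, x} W P' Q') :
    Separable.{u, v, w, x} W (fun c => P c ∧ P' c) (fun c => Q c ∧ Q' c) := by
  obtain ⟨C, hC, ζ, θ, hζ, hw, hx, h⟩ := h
  obtain ⟨D, hD, ζ', θ', hζ', hw', hx', h'⟩ := h'
  refine ⟨C ⊕ D, inferInstance, Sum.elim ζ ζ', baAnd θ θ', ?_, hw.baAnd hw', hx.baAnd hx',
    fun c => ⟨fun hP => ?_, fun hθ => ?_⟩⟩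
  · rintro (i | i)
    exacts [hζ i, hζ' i]
  · exact (baHolds_baAnd θ θ' _).2 ⟨(h c).1 hP.1, (h' c).1 hP.2⟩
  · have := (baHolds_baAnd θ θ' _).1 hθ
    exact ⟨(h c).2 this.1, (h' c).2 this.2⟩

theorem of_true : Separable.{u, v, w, x} W P fun _ => True := by
  exact ⟨Empty, inferInstance, Empty.elim, ⊤, fun i => i.elim,
    fun B _ K _ z' _ _ => baHolds_top z', fun B _ K _ z' _ _ => baHolds_top z',
    fun c => ⟨fun _ => baHolds_top _, fun _ => trivial⟩⟩

theorem forall_mem {α : Type*} (s : Finset α) {P Q : α → Context.{u, v, w} L σ → Prop}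
    (h : ∀ i ∈ s, Separable.{u, v, w, x} W (P i) (Q i)) :
    Separable.{u, v, w, x} W (fun c => ∀ i ∈ s, P i c) (fun c => ∀ i ∈ s, Q i c) := by
  classical
  induction s using Finset.induction_on with
  | empty => exact of_true.mono subset_rfl (fun _ => id) (by simp)
  | insert i s _ ih =>
    refine ((h i (Finset.mem_insert_self i s)).and
      (ih fun j hj => h j (Finset.mem_insert_of_mem hj))).mono subset_rfl ?_ ?_ <;> simp

theorem exists_mem {α : Type*} (s : Finset α) {P Q : α → Context.{u, v, w} L σ → Prop}
    (h : ∀ i ∈ s, Separable.{u, v, w, x} W (P i) (Q i)) :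
    Separable.{u, v, w, x} W (fun c => ∃ i ∈ s, P i c) (fun c => ∃ i ∈ s, Q i c) :=
  (forall_mem s fun i hi => (h i hi).not).not.mono subset_rfl (by simp) (by simp)

end Separable

/-! ### Quantification over sequences -/

/-- The minimum of `1` and the coordinates in `S`. -/
def foldMin {C : Type} (S : Finset C) : C(C → ℝ, ℝ) :=
  ⟨fun v => S.fold min 1 v, by
    classical
    induction S using Finset.induction_on with
    | empty => simpa using continuous_const
    | insert i S hi ih =>
      simp only [Finset.fold_insert hi]
      exact (continuous_apply i).min ih⟩

/-- The formula `sup_x min(1, min_{i ∈ S} ζ i)`. -/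
def supMin {τ : V → L.Sorts} {C : Type} [Finite C] (x : V) (ζ : C → Formula L τ)
    (S : Finset C) : Formula L τ :=
  .sup x (.conn (Nat.card C)
    ((foldMin S).comp ⟨fun v i => v (Finite.equivFin C i), by fun_prop⟩)
    fun i => ζ ((Finite.equivFin C).symm i))

theorem freeVars_supMin_subset {τ : V → L.Sorts} {C : Type} [Finite C] (x : V)
    {ζ : C → Formula L τ} {W : Set V} (h : ∀ i, (ζ i).freeVars ⊆ W) (S : Finset C) :
    (supMin x ζ S).freeVars ⊆ W \ {x} :=
  sdiff_subset_sdiff_left (iUnion_subset fun _ => h _)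

open Classical in
theorem eval_supMin {τ : V → L.Sorts} {C : Type} [Finite C] (x : V)
    (ζ : C → Formula L τ) (S : Finset C) (M : MetricStructure.{u, v} L)
    (a : ∀ x, M.carrier (τ x)) :
    (supMin x ζ S).eval M a = ⨆ b : M.carrier (τ x),
      S.fold min 1 fun i => (ζ i).eval M (Function.update a x b) := by
  simp [supMin, Formula.eval, foldMin]

open Classical in
theorem one_le_eval_supMin {τ : V → L.Sorts} {C : Type} [Finite C] {x : V}
    {ζ : C → Formula L τ} {S : Finset C} {M : MetricStructure.{u, v} L}
    {a : ∀ x, M.carrier (τ x)} (b : M.carrier (τ x))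
    (h : ∀ i ∈ S, 1 ≤ (ζ i).eval M (Function.update a x b)) :
    1 ≤ (supMin x ζ S).eval M a := by
  rw [eval_supMin]
  -- The cap at `1` bounds the range, so that the supremum is a genuine one; it does not affect
  -- either threshold.
  refine le_trans ?_ (le_ciSup ⟨1, ?_⟩ b)
  · exact Finset.le_fold_min _ |>.2 ⟨le_rfl, h⟩
  · rintro _ ⟨b, rfl⟩
    exact (Finset.fold_min_le _).2 (Or.inl le_rfl)

open Classical in
theorem exists_of_eval_supMin_pos {τ : V → L.Sorts} {C : Type} [Finite C] {x : V}
    {ζ : C → Formula L τ} {S : Finset C} {M : MetricStructure.{u, v} L}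
    {a : ∀ x, M.carrier (τ x)} (h : 0 < (supMin x ζ S).eval M a) :
    ∃ b, ∀ i ∈ S, 0 < (ζ i).eval M (Function.update a x b) := by
  rw [eval_supMin] at h
  obtain ⟨b, hb⟩ := exists_lt_of_lt_ciSup h
  exact ⟨b, ((Finset.lt_fold_min _).1 hb).2⟩

theorem PowerQuot.finsetInf_mk {ι : Type w} (I : Order.Ideal (Set ι)) {C : Type}
    (S : Finset C) (Y : C → Set ι) :
    (S.inf fun i => PowerQuot.mk I (Y i)) = PowerQuot.mk I (⋂ i ∈ S, Y i) := by
  classical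
  induction S using Finset.induction_on with
  | empty => simp; rfl
  | insert i S hi ih =>
    rw [Finset.inf_insert, ih, Finset.set_biInter_insert]
    rfl

/-- No loss occurs at the thresholds: an element with all `ζ i ≥ 1` makes the supremum at least `1`,
and a positive supremum has an element at which all `ζ i` are positive, even if it is not attained.
-/
theorem Separable.exists_update {W : Set V} {P Q : Context.{u, v, w} L σ → Prop}
    (h : Separable.{u, v, w, x} W P Q) (x : V) :
    Separable.{u, v, w, x} (W \ {x}) (fun c => ∃ b, P (c.update x b))
      (fun c => ∃ b, Q (c.update x b)) := by
  classical
  obtain ⟨C, hC, ζ, θ, hζ, hw, hx, h⟩ := h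
  refine ⟨Finset C, inferInstance, supMin x ζ, baExists θ, freeVars_supMin_subset x hζ,
    baIncreasing_baExists θ, baIncreasing_baExists θ, fun c => ⟨fun ⟨b, hb⟩ => ?_, fun hθ => ?_⟩⟩
  -- The witnesses `Y i` are the classes of `{ζ i(b) ≥ 1}`.
  · refine (baHolds_baExists θ _).2 ⟨_, (h (c.update x b)).1 hb, fun S => ?_⟩
    refine (PowerQuot.finsetInf_mk c.I S _).trans_le ((PowerQuot.mk_le_mk c.I).2 ?_)
    refine mem_ideal_of_subset c.I c.I.bot_mem fun j hj => hj.2 (one_le_eval_supMin (b j) ?_)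
    intro i hi
    exact Context.mem_region_update.1 (mem_iInter₂.1 hj.1 i hi)
  · obtain ⟨Y, hY, hS⟩ := (baHolds_baExists θ _).1 hθ
    choose Z hZ using fun i => PowerQuot.mk_surjective c.I (Y i)
    obtain rfl : (fun i => PowerQuot.mk c.I (Z i)) = Y := funext hZ
    replace hS : ∀ S : Finset C, (⋂ i ∈ S, Z i) \ c.region (Ioi 0) (supMin x ζ S) ∈ c.I :=
      fun S => (PowerQuot.mk_le_mk c.I).1 ((PowerQuot.finsetInf_mk c.I S Z).symm.trans_le (hS S))
    -- `X` collects the exceptional indices of all inclusions; it is in the ideal since there are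
    -- finitely many `S`.
    let X : Set c.ι := ⨆ S : Finset C, (⋂ i ∈ S, Z i) \ c.region (Ioi 0) (supMin x ζ S)
    have hX : X ∈ c.I := Order.Ideal.iSup_mem_iff.2 hS
    have hb : ∀ j, ∃ b : (c.M j).carrier (σ x).1, j ∉ X → ∀ i, j ∈ Z i →
        0 < (ζ i).eval (c.M j) (Function.update (c.at' j) x b) := by
      intro j
      by_cases hj : j ∈ X
      · exact ⟨Classical.choice ((c.M j).nonempty _), fun h => (h hj).elim⟩
      · have := Fintype.ofFinite C
        -- At an index outside `X`, the inclusion for the set of all labels `i` with `j ∈ Z i`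
        -- yields one element that serves all these labels at once.
        let S : Finset C := Finset.univ.filter fun i => j ∈ Z i
        have hjS : j ∈ c.region (Ioi 0) (supMin x ζ S) := by
          by_contra hjS
          refine hj (mem_iUnion.2 ⟨S, ?_, hjS⟩)
          simp [S]
        obtain ⟨b, hb⟩ := exists_of_eval_supMin_pos hjS
        exact ⟨b, fun _ i hi => hb i (by simpa [S] using hi)⟩
    choose b hb using hb
    refine ⟨b, (h _).2 (Context.Holds.mono (c := c.update x b) (Z := Z) hw (fun i => ?_) hY)⟩
    refine mem_ideal_of_subset c.I hX fun j hj => ?_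
    by_contra hjX
    exact hj.2 (Context.mem_region_update.2 (hb j hjX i hj.1))

end Separable

section Determined

variable {L : MetricLanguage.{u}} {V : Type y} {σ : V → L.Sorts × Layer}

/-! ## Terms and atomic formulas of the two-layered language -/

/-- The term of `L` that is obtained from a term of the two-layered language by forgetting the
layers and the quotient maps. -/
def Term.erase : ∀ {p : L.pair.Sorts}, Term L.pair σ p → Term L (fun x => (σ x).1) p.1
  | _, .var x => .var x
  | _, .app (PairFunc.base _ f) ts => .app f fun i => (ts i).erase
  | _, .app (PairFunc.proj _) ts => (ts (0 : Fin 1)).erase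

theorem Term.vars_erase {p : L.pair.Sorts} (t : Term L.pair σ p) : t.erase.vars = t.vars := by
  induction t with
  | var x => rfl
  | app F ts ih =>
    match F, ts, ih with
    | .base _ f, ts, ih => exact iUnion_congr ih
    | .proj _, ts, ih =>
      have h : (⋃ i : Fin 1, (ts i).vars) = (ts (0 : Fin 1)).vars := by
        refine (iUnion_congr fun i => ?_).trans (iUnion_const (ι := Fin 1) _)
        rw [Subsingleton.elim i 0]
      exact (ih (0 : Fin 1)).trans h.symm

/-- A quotient map sends the class of a sequence to the class of the same sequence, so every term is
computed pointwise by its erasure. -/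
theorem Context.eval_term (c : Context.{u, v, w} L σ) {p : L.pair.Sorts}
    (t : Term L.pair σ p) :
    t.eval (pairStructure c.M c.I c.J c.le)
        (fun x => ReducedSort.mk (layerIdeal c.I c.J (σ x).2) (c.seq x)) =
      ReducedSort.mk (layerIdeal c.I c.J p.2) fun j => t.erase.eval (c.M j) (c.at' j) := by
  induction t with
  | var x => rfl
  | app F ts ih =>
    match F, ts, ih with
    | .base b f, ts, ih =>
      refine Eq.trans ?_ (reducedFn_mk (I := layerIdeal c.I c.J b) f
        fun i j => (ts i).erase.eval (c.M j) (c.at' j))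
      exact congrArg (reducedFn c.M (layerIdeal c.I c.J b) f) (funext ih)
    | .proj s, ts, ih =>
      refine Eq.trans ?_ (reducedProj_mk c.le
        fun j => (ts (0 : Fin 1)).erase.eval (c.M j) (c.at' j))
      exact congrArg (reducedProj (I := c.I) c.J) (ih (0 : Fin 1))

theorem Context.holds_baNonzero {c : Context.{u, v, w} L σ} {Z : Unit → Set c.ι} :
    c.Holds baNonzero Z ↔ Z () ∉ c.I := by
  refine (baHolds_baNonzero _).trans (not_congr ?_)
  rw [← le_bot_iff]
  refine (PowerQuot.mk_le_mk c.I (Y := ∅)).trans ?_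
  rw [sdiff_empty]

theorem Context.holds_baU {c : Context.{u, v, w} L σ} {Z : Unit → Set c.ι} :
    c.Holds baU Z ↔ Z () ∉ c.J :=
  (baHolds_baU _).trans (not_congr (PowerQuot.mk_mem_idealMap c.I c.le))

theorem separable_notMem (b : Layer) (ζ : BaseFormula σ) :
    Separable.{u, v, w, x} ζ.freeVars
      (fun c => c.region (Ici 1) ζ ∉ layerIdeal c.I c.J b)
      (fun c => c.region (Ioi 0) ζ ∉ layerIdeal c.I c.J b) := by
  cases b with
  | fine => exact ⟨Unit, inferInstance, fun _ => ζ, baNonzero, fun _ => subset_rfl,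
      baIncreasing_baNonzero, baIncreasing_baNonzero,
      fun _ => ⟨fun h => Context.holds_baNonzero.2 h, fun h => Context.holds_baNonzero.1 h⟩⟩
  | coarse => exact ⟨Unit, inferInstance, fun _ => ζ, baU, fun _ => subset_rfl,
      baIncreasing_baU, baIncreasing_baU,
      fun _ => ⟨fun h => Context.holds_baU.2 h, fun h => Context.holds_baU.1 h⟩⟩

theorem separable_limsupAlong (b : Layer) (ζ : BaseFormula σ) {lo hi : ℝ}
    (hζ : ∀ (M : MetricStructure.{u, v} L) a, ζ.eval M a ∈ Icc lo hi) {r s : ℝ} (hrs : r < s) :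
    Separable.{u, v, w, x} ζ.freeVars
      (fun c => s ≤ limsupAlong (layerIdeal c.I c.J b) fun j => ζ.eval (c.M j) (c.at' j))
      (fun c => r < limsupAlong (layerIdeal c.I c.J b) fun j => ζ.eval (c.M j) (c.at' j)) := by
  obtain ⟨m, hrm, hms⟩ := exists_between hrs
  obtain ⟨m', hmm', hms'⟩ := exists_between hms
  -- With `r < m < m' < s`, this affine map turns `ζ ≥ m'` and `ζ > m` into the normalised
  -- thresholds `≥ 1` and `> 0`.
  let f : C(ℝ, ℝ) := ⟨fun t => (t - m) / (m' - m), by fun_prop⟩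
  refine (separable_notMem b (ζ.comp f)).mono (Formula.freeVars_comp f ζ).subset ?_ ?_
  · intro c hs hmem
    refine (hms'.trans_le hs).not_ge ?_
    refine limsupAlong_le inferInstance (fun j => hζ (c.M j) _) hmem fun j hj => ?_
    by_contra! h
    refine hj ?_
    change 1 ≤ (_ - m) / (m' - m)
    rw [le_div_iff₀ (by linarith)]
    linarith
  · intro c hmem
    by_contra! h
    obtain ⟨X, hX, hX'⟩ := exists_of_limsupAlong_lt (fun j => hζ (c.M j) (c.at' j))
      (h.trans_lt hrm)
    refine hmem (mem_ideal_of_subset _ hX fun j hj => ?_)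
    by_contra hjX
    have h0 : 0 < (ζ.eval (c.M j) (c.at' j) - m) / (m' - m) := hj
    rw [lt_div_iff₀ (by linarith)] at h0
    linarith [hX' j hjX]

/-! ## Connectives and quantifiers -/

/-- A bound independent of the structure provides the compact box for connectives and makes real
suprema and infima genuine. -/
theorem Formula.exists_abs_eval_le {τ : V → L.Sorts} (φ : Formula L τ) :
    ∃ B : ℝ, ∀ (M : MetricStructure.{u, v} L) a, |φ.eval M a| ≤ B := by
  classical
  induction φ with
  | @dist s t₁ t₂ =>
    refine ⟨L.diam s, fun M a => ?_⟩
    rw [eval, abs_of_nonneg dist_nonneg]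
    exact M.dist_le _ _ _
  | rel R ts =>
    refine ⟨max |L.relLo R| |L.relHi R|, fun M a => ?_⟩
    exact abs_le_max_abs_abs (M.rel_mem R _).1 (M.rel_mem R _).2
  | conn n f φ ih =>
    choose B hB using ih
    obtain ⟨b, hb⟩ := (isCompact_Icc (a := -B) (b := B)).exists_bound_of_continuousOn
      f.continuous.continuousOn
    exact ⟨b, fun M a => hb _ ⟨fun i => (abs_le.1 (hB i M a)).1, fun i => (abs_le.1 (hB i M a)).2⟩⟩
  | sup x φ ih =>
    obtain ⟨B, hB⟩ := ih
    refine ⟨B, fun M a => abs_le.2 ⟨?_, ciSup_le fun b => (abs_le.1 (hB M _)).2⟩⟩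
    refine le_ciSup_of_le ⟨B, ?_⟩ (Classical.choice (M.nonempty _)) (abs_le.1 (hB M _)).1
    rintro _ ⟨b, rfl⟩
    exact (abs_le.1 (hB M _)).2
  | inf x φ ih =>
    obtain ⟨B, hB⟩ := ih
    refine ⟨B, fun M a => abs_le.2 ⟨le_ciInf fun b => (abs_le.1 (hB M _)).1, ?_⟩⟩
    refine ciInf_le_of_le ⟨-B, ?_⟩ (Classical.choice (M.nonempty _)) (abs_le.1 (hB M _)).2
    rintro _ ⟨b, rfl⟩
    exact (abs_le.1 (hB M _)).1

theorem Context.exists_abs_value_le (φ : Formula L.pair σ) :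
    ∃ B : ℝ, ∀ c : Context.{u, v, w} L σ, |c.value φ| ≤ B :=
  φ.exists_abs_eval_le.imp fun _ hB _ => hB _ _

/-- Lower bounds for bounded functions of contexts that can be separated are preserved by
continuous functions. -/
theorem separable_continuous {W : Set V} {n : ℕ} (f : C(Fin n → ℝ, ℝ))
    {g : Fin n → Context.{u, v, w} L σ → ℝ} {B : Fin n → ℝ} (hB : ∀ i c, |g i c| ≤ B i)
    (hg : ∀ i (r s : ℝ), r < s → Separable.{u, v, w, x} W (fun c => s ≤ g i c) (fun c => r < g i c))
    {r s : ℝ} (hrs : r < s) :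
    Separable.{u, v, w, x} W (fun c => s ≤ f fun i => g i c) (fun c => r < f fun i => g i c) := by
  have hg' : ∀ i (r s : ℝ), r < s →
      Separable.{u, v, w, x} W (fun c => g i c ≤ r) (fun c => g i c < s) := fun i r s h =>
    (hg i r s h).not.mono subset_rfl (fun _ => not_lt.2) (fun _ => not_le.1)
  let K : Set (Fin n → ℝ) := Icc (-B) B ∩ {p | s ≤ f p}
  have hK : IsCompact K := isCompact_Icc.inter_right (isClosed_le continuous_const f.continuous)
  have hδ : ∀ p, ∃ δ > 0, p ∈ K → Metric.ball p δ ⊆ {q | r < f q} := by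
    intro p
    by_cases hp : p ∈ K
    · obtain ⟨δ, hδ, h⟩ := Metric.isOpen_iff.1 (isOpen_lt continuous_const f.continuous) p
        (show p ∈ {q | r < f q} from hrs.trans_le hp.2)
      exact ⟨δ, hδ, fun _ => h⟩
    · exact ⟨1, one_pos, fun h => (hp h).elim⟩
  choose δ hδ hball using hδ
  -- Half-radius balls cover `K`, while `r < f` on the full balls; the gap between `δ p / 2` and `δ
  -- p` is where the coordinate bounds are separated.
  obtain ⟨t, htK, ht⟩ := hK.elim_nhds_subcover (fun p => Metric.ball p (δ p / 2))
    fun p _ => Metric.ball_mem_nhds p (half_pos (hδ p))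
  have key := Separable.exists_mem t (fun p _ => Separable.forall_mem Finset.univ (fun i _ =>
    (hg i (p i - δ p) (p i - δ p / 2) (by linarith [hδ p])).and
      (hg' i (p i + δ p / 2) (p i + δ p) (by linarith [hδ p]))))
  refine key.mono subset_rfl ?_ ?_
  · intro c hc
    have hcK : (fun i => g i c) ∈ K :=
      ⟨⟨fun i => (abs_le.1 (hB i c)).1, fun i => (abs_le.1 (hB i c)).2⟩, hc⟩
    obtain ⟨p, hp, hcp⟩ := mem_iUnion₂.1 (ht hcK)
    refine ⟨p, hp, fun i _ => ?_⟩
    have h1 := (dist_le_pi_dist (fun i => g i c) p i).trans_lt hcp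
    rw [Real.dist_eq, abs_lt] at h1
    constructor <;> linarith
  · rintro c ⟨p, hp, h⟩
    refine hball p (htK p hp) ?_
    rw [Metric.mem_ball, dist_pi_lt_iff (hδ p)]
    intro i
    have := h i (Finset.mem_univ i)
    rw [Real.dist_eq, abs_lt]
    constructor <;> linarith

open Classical in
theorem Context.update_class (c : Context.{u, v, w} L σ) (x : V)
    (b : ∀ j, (c.M j).carrier (σ x).1) :
    (fun y => ReducedSort.mk (layerIdeal c.I c.J (σ y).2) ((c.update x b).seq y) :
      ∀ y, ReducedSort c.M (layerIdeal c.I c.J (σ y).2) (σ y).1) =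
    Function.update (fun y => ReducedSort.mk (layerIdeal c.I c.J (σ y).2) (c.seq y)) x
      (ReducedSort.mk (layerIdeal c.I c.J (σ x).2) b) := by
  funext y
  by_cases h : y = x
  · subst h
    simp [update]
  · simp [update, h]

/-- Every element of the reduced product is the class of a sequence, so the supremum may run over
sequences. -/
theorem Context.value_sup (c : Context.{u, v, w} L σ) (x : V) (φ : Formula L.pair σ) :
    c.value (.sup x φ) = ⨆ b, (c.update x b).value φ := by
  classical
  refine Eq.trans (Function.Surjective.iSup_comp (f := fun b : ∀ j, (c.M j).carrier (σ x).1 =>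
    ReducedSort.mk (layerIdeal c.I c.J (σ x).2) b) (fun p => ⟨p.rep, ReducedSort.mk_rep p⟩)
    _).symm (iSup_congr fun b => ?_)
  exact congrArg (φ.eval (pairStructure c.M c.I c.J c.le)) (c.update_class x b).symm

theorem Context.value_inf (c : Context.{u, v, w} L σ) (x : V) (φ : Formula L.pair σ) :
    c.value (.inf x φ) = ⨅ b, (c.update x b).value φ := by
  classical
  refine Eq.trans (Function.Surjective.iInf_comp (f := fun b : ∀ j, (c.M j).carrier (σ x).1 =>
    ReducedSort.mk (layerIdeal c.I c.J (σ x).2) b) (fun p => ⟨p.rep, ReducedSort.mk_rep p⟩)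
    _).symm (iInf_congr fun b => ?_)
  exact congrArg (φ.eval (pairStructure c.M c.I c.J c.le)) (c.update_class x b).symm

instance (c : Context.{u, v, w} L σ) (x : V) : Nonempty (∀ j, (c.M j).carrier (σ x).1) :=
  ⟨c.seq x⟩

/-- The properties `s ≤ φ` and `r < φ` can be separated if `r < s`. -/
theorem separable_value (φ : Formula L.pair σ) {r s : ℝ} (hrs : r < s) :
    Separable.{u, v, w, x} φ.freeVars (fun c => s ≤ c.value φ) (fun c => r < c.value φ) := by
  induction φ generalizing r s with
  | @dist p t₁ t₂ =>
    refine (separable_limsupAlong p.2 (.dist t₁.erase t₂.erase) (lo := 0) (hi := L.diam p.1)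
      (fun M a => dist_mem_Icc M _ _) hrs).mono ?_ ?_ ?_
    · simp [Formula.freeVars, Term.vars_erase]
    all_goals
      intro c
      simp only [Context.value, Formula.eval, Context.eval_term]
      exact id
  | rel R ts =>
    refine (separable_limsupAlong R.1 (.rel R.2 fun i => (ts i).erase)
      (fun M a => M.rel_mem _ _) hrs).mono ?_ ?_ ?_
    · exact (iUnion_congr fun i => (ts i).vars_erase).subset
    all_goals
      intro c
      have : c.value (.rel R ts) = limsupAlong (layerIdeal c.I c.J R.1) fun j =>
          (c.M j).rel R.2 fun i => (ts i).erase.eval (c.M j) (c.at' j) := by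
        refine Eq.trans ?_ (reducedRel_mk (I := layerIdeal c.I c.J R.1) R.2
          fun i j => (ts i).erase.eval (c.M j) (c.at' j))
        exact congrArg (reducedRel c.M (layerIdeal c.I c.J R.1) R.2)
          (funext fun i => c.eval_term (ts i))
      rw [this]
      exact id
  | conn n f φ ih =>
    choose B hB using fun i => Context.exists_abs_value_le (φ i)
    exact separable_continuous f hB (fun i r s h =>
      (ih i h).mono (subset_iUnion (fun i => (φ i).freeVars) i) (fun _ => id) (fun _ => id)) hrs
  | sup x φ ih =>
    obtain ⟨m, hrm, hms⟩ := exists_between hrs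
    -- The supremum need not be attained, but some sequence gives a value above the intermediate `m
    -- < s`.
    refine ((ih hrm).exists_update x).mono subset_rfl ?_ ?_
    · intro c hc
      rw [c.value_sup] at hc
      obtain ⟨b, hb⟩ := exists_lt_of_lt_ciSup (hms.trans_le hc)
      exact ⟨b, hb.le⟩
    · rintro c ⟨b, hb⟩
      obtain ⟨B, hB⟩ := Context.exists_abs_value_le φ
      rw [c.value_sup]
      refine hb.trans_le (le_ciSup (f := fun b => (c.update x b).value φ) ⟨B, ?_⟩ b)
      rintro _ ⟨b, rfl⟩
      exact (abs_le.1 (hB _)).2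
  | inf x φ ih =>
    obtain ⟨m, hrm, hms⟩ := exists_between hrs
    -- An infimum is bounded below when no sequence violates the bound. Values above `m` only give
    -- an infimum `≥ m`, whence the choice `r < m`.
    refine ((ih hms).not.exists_update x).not.mono subset_rfl ?_ ?_
    · rintro c hc ⟨b, hb⟩
      obtain ⟨B, hB⟩ := Context.exists_abs_value_le φ
      rw [c.value_inf] at hc
      refine hb (hc.trans (ciInf_le (f := fun b => (c.update x b).value φ) ⟨-B, ?_⟩ b))
      rintro _ ⟨b, rfl⟩
      exact (abs_le.1 (hB _)).1
    · intro c hc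
      rw [c.value_inf]
      refine hrm.trans_le (le_ciInf fun b => ?_)
      by_contra h
      exact hc ⟨b, fun h' => h h'.le⟩

end Determined

end ContLogic

end

/-! ### From separation to determinedness -/

theorem theoremT (L : ContLogic.MetricLanguage.{u}) (k : ℕ) (hk : 2 ≤ k)
    {V : Type y} (σ : V → L.Sorts × ContLogic.Layer) (φ : ContLogic.Formula L.pair σ) :
    ContLogic.IsDetermined.{u, v, w, x, y} k φ := by
  classical
  have hk0 : (0 : ℝ) < k := by exact_mod_cast Nat.lt_of_lt_of_le Nat.zero_lt_two hk
  have hrs : ∀ l : Fin (k + 1), ((l : ℕ) - 1 : ℝ) / k < ((l : ℕ) + 1 : ℝ) / k := fun l =>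
    div_lt_div_of_pos_right (by linarith) hk0
  choose C hC ζ θ hζ hw hx h using fun l =>
    ContLogic.separable_value.{u, v, w, x} φ (hrs l)
  have := fun l => Fintype.ofFinite (C l)
  let F := Finset.univ.image fun i : Σ l, C l => ζ i.1 i.2
  -- Only the threshold `t = 0` is used. Labels with the same formula may be merged, since they have
  -- the same interpretation.
  let f (l) (i : C l) : F × Set.Icc (0 : ℚ) 1 :=
    (⟨ζ l i, Finset.mem_image_of_mem (fun i : Σ l, C l => ζ i.1 i.2) (Finset.mem_univ ⟨l, i⟩)⟩,
      ⟨0, le_rfl, zero_le_one⟩)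
  refine ⟨F, fun l => (θ l).relabel (f l), ?_, fun l => (hx l).relabel (f l), ?_⟩
  · intro ξ hξ
    obtain ⟨i, -, rfl⟩ := Finset.mem_image.1 hξ
    exact hζ i.1 i.2
  · intro ι M I J _ _ hIJ a l value Z holds
    let c : ContLogic.Context.{u, v, w} L σ := ⟨ι, M, I, J, hIJ, a⟩
    have key : holds ↔ c.Holds (θ l) fun i => c.region (Set.Ioi 0) (ζ l i) := by
      refine (ContLogic.baHolds_relabel (θ l) (f l) Z).trans (iff_of_eq ?_)
      refine congrArg _ (funext fun i => congrArg (ContLogic.PowerQuot.mk I) ?_)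
      ext j
      change ((0 : ℚ) : ℝ) < _ ↔ (0 : ℝ) < _
      rw [Rat.cast_zero]
      rfl
    rw [key]
    refine ⟨fun hv => ((h l c).1 hv.le).mono (hw l) fun i => ?_, (h l c).2⟩
    refine ContLogic.mem_ideal_of_subset I I.bot_mem ?_
    exact fun j hj => hj.2 (lt_of_lt_of_le zero_lt_one (show (1 : ℝ) ≤ _ from hj.1))
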